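/- Let $(\mathcal{X},\mathcal{N},\pi)$ range over a family (for instance a sequence) of triples, where $\mathcal{X}$ is a finite set with at least two elements, $\mathcal{N}$ is a neighborhood relation on $\mathcal{X}$ such that $x\notin\mathcal{N}(x)$, $x\in\mathcal{N}(x')$ whenever $x'\in\mathcal{N}(x)$, and $(\mathcal{X},\mathcal{N})$ is connected, and $\pi$ is a strictly positive probability distribution on $\mathcal{X}$. Write $M=\max_{x}|\mathcal{N}(x)|$, $\pi_{\min}=\min_x\pi(x)$, let $x^*$ be a maximizer of $\pi$, and put $$R=\min_{x\neq x^*}\ \max_{y\in\mathcal{N}(x)}\frac{\pi(y)}{\pi(x)} .$$ Assume $R>M^2$, put $\ell=M$, and let $L$ be a real number with $M^2<L\le R$. Let $h(u)=\mathrm{clip}(u,\ell,L)$, i.e. $h(u)=\ell$ if $u<\ell$, $h(u)=u$ if $\ell\le u\le L$, and $h(u)=L$ if $u>L$. Let $$\mathsf{K}_h(x,x')=\frac{h(\pi(x')/\pi(x))}{\sum_{\tilde x\in\mathcal{N}(x)}h(\pi(\tilde x)/\pi(x))}\,\mathbf{1}_{\mathcal{N}(x)}(x'),$$ let $\mathsf{P}_h$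 be the informed Metropolis--Hastings transition matrix, given by $\mathsf{P}_h(x,x')=\mathsf{K}_h(x,x')\min\Bigl\{1,\frac{\pi(x')\mathsf{K}_h(x',x)}{\pi(x)\mathsf{K}_h(x,x')}\Bigr\}$ for $x'\ne x$ (equal to $0$ if $x'\notin\mathcal{N}(x)$) and $\mathsf{P}_h(x,x)=1-\sum_{\tilde x\ne x}\mathsf{P}_h(x,\tilde x)$, and let $\mathsf{P}_h^{\mathrm{lazy}}=(\mathsf{P}_h+\mathsf{I})/2$. For $\epsilon\in(0,1/2)$ let $$\tau(\mathsf{P},\epsilon)=\max_{x\in\mathcal{X}}\min\{t\in\mathbb{N}:\|\mathsf{P}^t(x,\cdot)-\pi\|_{\mathrm{TV}}\le\epsilon\},\qquad \|\zeta-\pi\|_{\mathrm{TV}}=\sup_{A\subset\mathcal{X}}|\zeta(A)-\pi(A)| .$$ If, along the family, $$\frac{M^2\log(1/\pi_{\min})}{L\,\log(L/M)}=o(1),$$ then $$\tau(\mathsf{P}_h^{\mathrm{lazy}},\epsilon)\ \lesssim\ \frac{4\log(2e/\epsilon)}{\log(L/M)}\,\log\Bigl(\frac{1}{\pi_{\min}}\Bigr),$$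 that is, for every $\eta>0$, eventually along the family, the left-hand side is finite and at most $(1+\eta)$ times the right-hand side, simultaneously for all $\epsilon\in(0,1/2)$. -/

import Mathlib

noncomputable section

namespace InformedMH

variable {X : Type*} [Fintype X] [DecidableEq X]

/-! ## Total variation distance and mixing times -/

/-- Total variation distance `sup_A |ζ(A) - π(A)|` of two (probability) vectors on a finite set. -/
def tvDist (ζ π : X → ℝ) : ℝ :=
  ⨆ A : Finset X, |∑ x ∈ A, ζ x - ∑ x ∈ A, π x|

/-- Mixing time from the initial state `x`: the least `t` with `‖P^t(x, ·) - π‖_TV ≤ ε`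
(`⊤` if there is none). -/
def mixingTimeFrom (P : Matrix X X ℝ) (π : X → ℝ) (ε : ℝ) (x : X) : ℕ∞ :=
  ⨅ t ∈ {t : ℕ | tvDist ((P ^ t) x) π ≤ ε}, (t : ℕ∞)

/-- Mixing time: the maximum over the initial states. -/
def mixingTime (P : Matrix X X ℝ) (π : X → ℝ) (ε : ℝ) : ℕ∞ :=
  ⨆ x : X, mixingTimeFrom P π ε x

/-- The lazy version `(P + I) / 2` of a transition matrix. -/
def lazy (P : Matrix X X ℝ) : Matrix X X ℝ :=
  (1 / 2 : ℝ) • (P + 1)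

/-! ## The target distribution

The neighborhood relation is the adjacency of a simple graph `G` on `X`. -/

/-- `π` is a probability distribution charging every point. -/
structure IsPosDistribution (π : X → ℝ) : Prop where
  pos : ∀ x, 0 < π x
  sum_eq_one : ∑ x, π x = 1

/-- The smallest point mass of `π`. -/
def piMin (π : X → ℝ) : ℝ := ⨅ x, π x

/-- `R = min_{x ≠ x*} max_{y ∈ N(x)} π(y) / π(x)`. -/
def tailRatio (G : SimpleGraph X) (π : X → ℝ) (xstar : X) : ℝ :=
  ⨅ x : {x : X // x ≠ xstar}, ⨆ y : {y : X // G.Adj x y}, π y / π x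

/-! ## Informed Metropolis–Hastings -/

/-- `clip(u, ℓ, L)`. -/
def clip (u l L : ℝ) : ℝ :=
  if u < l then l else if u ≤ L then u else L

variable (G : SimpleGraph X) [DecidableRel G.Adj] (π : X → ℝ) (l L : ℝ)

/-- The normalizing constant `Z_h(x)` for `h = clip(·, ℓ, L)`. -/
def normConst (x : X) : ℝ :=
  ∑ y ∈ G.neighborFinset x, clip (π y / π x) l L

/-- The informed proposal `K_h(x, y)` for `h = clip(·, ℓ, L)`. -/
def informedProposal (x y : X) : ℝ :=
  if G.Adj x y then clip (π y / π x) l L / normConst G π l L x else 0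

/-- Off-diagonal entries of the informed Metropolis–Hastings transition matrix: the proposal
probability times the acceptance probability. -/
def informedMove (x y : X) : ℝ :=
  informedProposal G π l L x y *
    min 1 ((π y * informedProposal G π l L y x) / (π x * informedProposal G π l L x y))

/-- The informed Metropolis–Hastings transition matrix `P_h` for `h = clip(·, ℓ, L)`. -/
def informedMH : Matrix X X ℝ := fun x y =>
  if y = x then 1 - ∑ z ∈ Finset.univ.erase x, informedMove G π l L x z
  else informedMove G π l L x y

end InformedMH

end

/-! The potential is `f = log (π xs / π ·)`, with values in `[0, F]`, where `F = log (1 / piMin π)`.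
Away from the mode `xs`, one step of the informed chain lowers `f` on average by at least `(1 -
2M²/L) log (L/M)`. If all proposals were accepted with weights `h`, the gain in `log π` would be at
least `∑ (h/Z) log h`, and Gibbs' inequality with at most `M` neighbours and `Z ≥ L` bounds this
below by `log (L/M)`. Moves with ratio at least `M` are always accepted; every other neighbour costs
at most `2 (M/L) log (L/M)` (`informedMove_mul_log_ge`, `informedMH_drift`).

An additive drift `c` of the lazy chain on a potential bounded by `F` is a multiplicative drift with
factor `1 - c/F`, so `f` is a supersolution for the chain killed at `xs`. Hence mean-zero functions
contract in `L²(π)` at rate `1 - c/F`. Passing from `L²` to a pointwise bound usually costs the mass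
of the starting point; here it is done only at `xs`, whose mass is bounded below. The bound is then
carried to all other states by comparison with `1 + f/F`, at half the rate (`tvDist_lazy_pow_le`).
Laziness and this halving give the constant `4`. -/

namespace InformedMH

/-! ### Reversible kernels: Dirichlet forms and `L²` contraction. -/

section Reversible

variable {X : Type*} [Fintype X]

/-- The quadratic form of `P` in `L²(π)`. -/
def energy (P : Matrix X X ℝ) (π : X → ℝ) (g k : X → ℝ) : ℝ :=
  ∑ x, ∑ y, π x * P x y * (g x * k y)

/-- The squared norm in `L²(π)`. -/
def sqNorm (π g : X → ℝ) : ℝ := ∑ x, π x * g x ^ 2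

variable {P : Matrix X X ℝ} {π : X → ℝ}

theorem sqNorm_nonneg (hπ : ∀ x, 0 < π x) (g : X → ℝ) : 0 ≤ sqNorm π g :=
  Finset.sum_nonneg fun x _ => mul_nonneg (hπ x).le (sq_nonneg _)

theorem energy_eq_sum_mulVec (g k : X → ℝ) :
    energy P π g k = ∑ x, π x * (g x * P.mulVec k x) := by
  unfold energy Matrix.mulVec dotProduct
  refine Finset.sum_congr rfl fun x _ => ?_
  rw [Finset.mul_sum, Finset.mul_sum]
  exact Finset.sum_congr rfl fun y _ => by ring

theorem energy_comm (hrev : ∀ x y, π x * P x y = π y * P y x) (g k : X → ℝ) :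
    energy P π g k = energy P π k g := by
  unfold energy
  rw [Finset.sum_comm]
  refine Finset.sum_congr rfl fun x _ => Finset.sum_congr rfl fun y _ => ?_
  rw [hrev y x]; ring

theorem sum_mul_mulVec (hrev : ∀ x y, π x * P x y = π y * P y x) (hrow : ∀ x, ∑ y, P x y = 1)
    (g : X → ℝ) : ∑ x, π x * P.mulVec g x = ∑ x, π x * g x := by
  unfold Matrix.mulVec dotProduct
  simp_rw [Finset.mul_sum]
  rw [Finset.sum_comm]
  refine Finset.sum_congr rfl fun y _ => ?_
  calc ∑ x, π x * (P x y * g y) = ∑ x, π y * P y x * g y :=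
        Finset.sum_congr rfl fun x _ => by rw [← mul_assoc, hrev x y]
    _ = π y * g y := by rw [← Finset.sum_mul, ← Finset.mul_sum, hrow y, mul_one]

/-- Ground-state argument: by AM-GM, `2 g(x) g(y) ≤ g(x)² f(y)/f(x) + g(y)² f(x)/f(y)`. By
reversibility the two halves have equal sums, and summing over `y` leaves `P f / f ≤ lam`. Since `g`
vanishes at `xs`, the possible value `f xs = 0` does no harm. -/
theorem energy_le_of_supersolution (hπ : ∀ x, 0 < π x)
    (hrev : ∀ x y, π x * P x y = π y * P y x) (hP : ∀ x y, 0 ≤ P x y)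
    {xs : X} {f : X → ℝ} {lam : ℝ} (hfpos : ∀ x, x ≠ xs → 0 < f x)
    (hf : ∀ x, x ≠ xs → P.mulVec f x ≤ lam * f x) (hfxs : 0 ≤ f xs)
    {g : X → ℝ} (hg : g xs = 0) : energy P π g g ≤ lam * sqNorm π g := by
  have key : ∀ x y, π x * P x y * (g x * g y) ≤
      (π x * P x y * (g x ^ 2 * (f y / f x)) + π y * P y x * (g y ^ 2 * (f x / f y))) / 2 := by
    intro x y
    rw [← hrev x y]
    have hw : 0 ≤ π x * P x y := mul_nonneg (hπ x).le (hP x y)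
    have hf0 : ∀ z, 0 ≤ f z := fun z => by
      by_cases hz : z = xs
      · rw [hz]; exact hfxs
      · exact (hfpos z hz).le
    have hgg : 2 * (g x * g y) ≤ g x ^ 2 * (f y / f x) + g y ^ 2 * (f x / f y) := by
      have hn : 0 ≤ g x ^ 2 * (f y / f x) + g y ^ 2 * (f x / f y) :=
        add_nonneg (mul_nonneg (sq_nonneg _) (div_nonneg (hf0 _) (hf0 _)))
          (mul_nonneg (sq_nonneg _) (div_nonneg (hf0 _) (hf0 _)))
      by_cases hx : x = xs
      · subst hx; rw [hg] at hn ⊢; simpa using hn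
      by_cases hy : y = xs
      · subst hy; rw [hg] at hn ⊢; simpa using hn
      have h1 := hfpos x hx
      have h2 := hfpos y hy
      have : g x ^ 2 * (f y / f x) + g y ^ 2 * (f x / f y) - 2 * (g x * g y)
          = (g x * f y - g y * f x) ^ 2 / (f x * f y) := by
        field_simp; ring
      have h3 : 0 ≤ (g x * f y - g y * f x) ^ 2 / (f x * f y) := by positivity
      linarith
    nlinarith [mul_le_mul_of_nonneg_left hgg hw]
  have h1 : energy P π g g ≤ ∑ x, ∑ y, π x * P x y * (g x ^ 2 * (f y / f x)) := by
    calc energy P π g g ≤ ∑ x, ∑ y, (π x * P x y * (g x ^ 2 * (f y / f x)) +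
            π y * P y x * (g y ^ 2 * (f x / f y))) / 2 :=
          Finset.sum_le_sum fun x _ => Finset.sum_le_sum fun y _ => key x y
      _ = _ := by
          simp_rw [add_div, Finset.sum_add_distrib, ← Finset.sum_div]
          rw [Finset.sum_comm (f := fun x y => π y * P y x * (g y ^ 2 * (f x / f y)))]
          ring
  refine h1.trans ?_
  unfold sqNorm
  rw [Finset.mul_sum]
  refine Finset.sum_le_sum fun x _ => ?_
  by_cases hx : x = xs
  · subst hx; simp [hg]
  have hfx := hfpos x hx
  have h2 : ∑ y, π x * P x y * (g x ^ 2 * (f y / f x)) =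
      π x * g x ^ 2 * (P.mulVec f x / f x) := by
    unfold Matrix.mulVec dotProduct
    rw [Finset.sum_div, Finset.mul_sum]
    exact Finset.sum_congr rfl fun y _ => by ring
  rw [h2]
  have h3 : P.mulVec f x / f x ≤ lam := (div_le_iff₀ hfx).2 (hf x hx)
  have := mul_le_mul_of_nonneg_left h3 (mul_nonneg (hπ x).le (sq_nonneg (g x)))
  linarith

/-- Subtracting `g xs` makes `g` vanish at `xs` and adds the same `(g xs)²` to the energy and to the
squared norm; as `lam ≤ 1`, this only helps. -/
theorem energy_le_of_mean_zero (hπ : IsPosDistribution π)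
    (hrev : ∀ x y, π x * P x y = π y * P y x) (hP : ∀ x y, 0 ≤ P x y)
    (hrow : ∀ x, ∑ y, P x y = 1)
    {xs : X} {f : X → ℝ} {lam : ℝ} (hlam : lam ≤ 1) (hfpos : ∀ x, x ≠ xs → 0 < f x)
    (hf : ∀ x, x ≠ xs → P.mulVec f x ≤ lam * f x) (hfxs : 0 ≤ f xs)
    {g : X → ℝ} (hg : ∑ x, π x * g x = 0) : energy P π g g ≤ lam * sqNorm π g := by
  have h := energy_le_of_supersolution hπ.pos hrev hP hfpos hf hfxs
    (g := fun x => g x - g xs) (sub_self _)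
  have hmv : ∀ x, P.mulVec (fun x => g x - g xs) x = P.mulVec g x - g xs := fun x => by
    unfold Matrix.mulVec dotProduct
    simp_rw [mul_sub, Finset.sum_sub_distrib, ← Finset.sum_mul, hrow x, one_mul]
  have hinv := sum_mul_mulVec hrev hrow g
  have e1 : energy P π (fun x => g x - g xs) (fun x => g x - g xs)
      = energy P π g g + g xs ^ 2 := by
    rw [energy_eq_sum_mulVec, energy_eq_sum_mulVec]
    have : ∀ x, π x * ((g x - g xs) * P.mulVec (fun x => g x - g xs) x) =
        π x * (g x * P.mulVec g x) - g xs * (π x * g x) - g xs * (π x * P.mulVec g x)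
          + g xs ^ 2 * π x := fun x => by rw [hmv]; ring
    simp_rw [this, Finset.sum_add_distrib, Finset.sum_sub_distrib, ← Finset.mul_sum]
    rw [hinv, hg, hπ.sum_eq_one]; ring
  have e2 : sqNorm π (fun x => g x - g xs) = sqNorm π g + g xs ^ 2 := by
    unfold sqNorm
    have : ∀ x, π x * (g x - g xs) ^ 2 =
        π x * g x ^ 2 - 2 * g xs * (π x * g x) + g xs ^ 2 * π x := fun x => by ring
    simp_rw [this, Finset.sum_add_distrib, Finset.sum_sub_distrib, ← Finset.mul_sum]
    rw [hg, hπ.sum_eq_one]; ring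
  rw [e1, e2] at h
  nlinarith [mul_nonneg (sub_nonneg.2 hlam) (sq_nonneg (g xs))]

theorem energy_add_smul (g k : X → ℝ) (s : ℝ) (hrev : ∀ x y, π x * P x y = π y * P y x) :
    energy P π (g + s • k) (g + s • k)
      = energy P π g g + 2 * s * energy P π g k + s ^ 2 * energy P π k k := by
  have h : energy P π (g + s • k) (g + s • k)
      = energy P π g g + s * energy P π g k + s * energy P π k g + s ^ 2 * energy P π k k := by
    unfold energy
    simp_rw [Finset.mul_sum, ← Finset.sum_add_distrib]
    refine Finset.sum_congr rfl fun x _ => Finset.sum_congr rfl fun y _ => ?_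
    simp only [Pi.add_apply, Pi.smul_apply, smul_eq_mul]; ring
  rw [h, energy_comm hrev k g]; ring

theorem energy_sq_le (hrev : ∀ x y, π x * P x y = π y * P y x)
    (hpsd : ∀ g, 0 ≤ energy P π g g) (g k : X → ℝ) :
    energy P π g k ^ 2 ≤ energy P π g g * energy P π k k := by
  have h := discrim_le_zero (a := energy P π k k) (b := 2 * energy P π g k)
    (c := energy P π g g) fun s => by
      have := hpsd (g + s • k)
      rw [energy_add_smul g k s hrev] at this
      linarith
  rw [discrim] at h
  linarith

/-- Cauchy–Schwarz for the positive semidefinite form, applied to `P g` and `g`, replaces the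
spectral theorem: `‖Pg‖⁴ ≤ E(Pg, Pg) E(g, g) ≤ lam² ‖Pg‖² ‖g‖²`. -/
theorem sqNorm_mulVec_le (hπ : IsPosDistribution π)
    (hrev : ∀ x y, π x * P x y = π y * P y x) (hrow : ∀ x, ∑ y, P x y = 1)
    (hpsd : ∀ g, 0 ≤ energy P π g g) {lam : ℝ} (hlam : 0 ≤ lam)
    (hgap : ∀ g : X → ℝ, ∑ x, π x * g x = 0 → energy P π g g ≤ lam * sqNorm π g)
    {g : X → ℝ} (hg : ∑ x, π x * g x = 0) :
    sqNorm π (P.mulVec g) ≤ lam ^ 2 * sqNorm π g := by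
  have h0 : energy P π (P.mulVec g) g = sqNorm π (P.mulVec g) := by
    rw [energy_eq_sum_mulVec]; exact Finset.sum_congr rfl fun x _ => by ring
  have h1 := energy_sq_le hrev hpsd (P.mulVec g) g
  have h2 := hgap g hg
  have h3 := hgap (P.mulVec g) (by rw [sum_mul_mulVec hrev hrow, hg])
  rw [h0] at h1
  have n1 := sqNorm_nonneg hπ.pos g
  have n2 := sqNorm_nonneg hπ.pos (P.mulVec g)
  have h4 := mul_le_mul h3 h2 (hpsd g) (mul_nonneg hlam n2)
  rcases n2.eq_or_lt with h | h
  · rw [← h]; positivity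
  · refine le_of_mul_le_mul_left ?_ h
    nlinarith

theorem abs_mulVec_le (hP : ∀ x y, 0 ≤ P x y) {g u : X → ℝ} (h : ∀ y, |g y| ≤ u y) (x : X) :
    |P.mulVec g x| ≤ P.mulVec u x :=
  (Finset.abs_sum_le_sum_abs _ _).trans <| Finset.sum_le_sum fun y _ => by
    rw [abs_mul, abs_of_nonneg (hP x y)]
    exact mul_le_mul_of_nonneg_left (h y) (hP x y)

end Reversible

/-! ### Lazy chains: from additive drift to total variation. -/

section Lazy

variable {X : Type*} [DecidableEq X] {Q : Matrix X X ℝ} {π : X → ℝ}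

theorem lazy_apply (x y : X) : lazy Q x y = (Q x y + if x = y then 1 else 0) / 2 := by
  simp [lazy, Matrix.one_apply]; ring

theorem lazy_nonneg (hQ : ∀ x y, 0 ≤ Q x y) (x y : X) : 0 ≤ lazy Q x y := by
  rw [lazy_apply]; have := hQ x y; split_ifs <;> linarith

theorem lazy_reversible (hrev : ∀ x y, π x * Q x y = π y * Q y x) (x y : X) :
    π x * lazy Q x y = π y * lazy Q y x := by
  rw [lazy_apply, lazy_apply]
  by_cases h : x = y
  · subst h; rfl
  · rw [if_neg h, if_neg (Ne.symm h)]; linarith [hrev x y]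

variable [Fintype X]

theorem lazy_sum_row (hrow : ∀ x, ∑ y, Q x y = 1) (x : X) : ∑ y, lazy Q x y = 1 := by
  simp_rw [lazy_apply, ← Finset.sum_div, Finset.sum_add_distrib, hrow x]
  simp

theorem lazy_mulVec (f : X → ℝ) (x : X) : (lazy Q).mulVec f x = (Q.mulVec f x + f x) / 2 := by
  simp [lazy, Matrix.smul_mulVec, Matrix.add_mulVec]; ring

/-- The form equals `¼ ∑ π(x) Q(x,y) (g(x) + g(y))²`. -/
theorem energy_lazy_nonneg (hπ : ∀ x, 0 < π x) (hrev : ∀ x y, π x * Q x y = π y * Q y x)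
    (hQ : ∀ x y, 0 ≤ Q x y) (hrow : ∀ x, ∑ y, Q x y = 1) (g : X → ℝ) :
    0 ≤ energy (lazy Q) π g g := by
  have h1 : energy (lazy Q) π g g = (energy Q π g g + sqNorm π g) / 2 := by
    rw [energy_eq_sum_mulVec, energy_eq_sum_mulVec, sqNorm, ← Finset.sum_add_distrib,
      Finset.sum_div]
    exact Finset.sum_congr rfl fun x _ => by rw [lazy_mulVec]; ring
  have hA : ∑ x, ∑ y, π x * Q x y * g x ^ 2 = sqNorm π g :=
    Finset.sum_congr rfl fun x _ => by
      rw [← Finset.sum_mul, ← Finset.mul_sum, hrow x, mul_one]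
  have hB : ∑ x, ∑ y, π x * Q x y * g y ^ 2 = sqNorm π g := by
    rw [Finset.sum_comm, ← hA]
    exact Finset.sum_congr rfl fun x _ => Finset.sum_congr rfl fun y _ => by rw [hrev y x]
  have h2 : ∑ x, ∑ y, π x * Q x y * (g x + g y) ^ 2 = 2 * (energy Q π g g + sqNorm π g) := by
    have : ∀ x y, π x * Q x y * (g x + g y) ^ 2 = π x * Q x y * g x ^ 2 + π x * Q x y * g y ^ 2
        + 2 * (π x * Q x y * (g x * g y)) := fun x y => by ring
    simp_rw [this, Finset.sum_add_distrib, ← Finset.mul_sum]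
    rw [hA, hB, energy]; ring
  have h3 : 0 ≤ ∑ x, ∑ y, π x * Q x y * (g x + g y) ^ 2 :=
    Finset.sum_nonneg fun x _ => Finset.sum_nonneg fun y _ =>
      mul_nonneg (mul_nonneg (hπ x).le (hQ x y)) (sq_nonneg _)
  linarith

/-- An additive drift condition towards an atom carrying mass at least `1 / 4` gives geometric
convergence of a lazy reversible chain, with no dependence on the smallest mass of `π` other than
through the bound `F` on the drift function. -/
theorem tvDist_lazy_pow_le (hπ : IsPosDistribution π)
    (hrev : ∀ x y, π x * Q x y = π y * Q y x) (hQ : ∀ x y, 0 ≤ Q x y)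
    (hrow : ∀ x, ∑ y, Q x y = 1) {xs : X} (hxs : 1 / 4 ≤ π xs)
    {f : X → ℝ} {F c : ℝ} (hf0 : ∀ x, 0 ≤ f x) (hfF : ∀ x, f x ≤ F) (hF : 0 < F)
    (hc : 0 < c) (hcF : c ≤ F)
    (hdrift : ∀ x, x ≠ xs → Q.mulVec f x ≤ f x - 2 * c) (t : ℕ) (x : X) :
    tvDist ((lazy Q ^ t) x) π ≤ 2 * (1 - c / (2 * F)) ^ t := by
  have hPrev := lazy_reversible hrev
  have hP := lazy_nonneg hQ
  have hProw := lazy_sum_row hrow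
  have hPd : ∀ x, x ≠ xs → (lazy Q).mulVec f x ≤ f x - c := fun x hx => by
    rw [lazy_mulVec]; linarith [hdrift x hx]
  set P := lazy Q with hPdef
  have hfpos : ∀ x, x ≠ xs → 0 < f x := fun x hx => by
    have h1 : 0 ≤ P.mulVec f x := Finset.sum_nonneg fun y _ => mul_nonneg (hP x y) (hf0 y)
    linarith [hPd x hx]
  have hcF1 : c / F ≤ 1 := (div_le_one hF).2 hcF
  have hcF0 : 0 < c / F := div_pos hc hF
  have hcF2 : c / (2 * F) = c / F / 2 := by field_simp
  set q := c / F with hq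
  have hqF : c = q * F := by rw [hq]; field_simp
  -- Since `f ≤ F`, the additive drift gives `P f ≤ f - q F ≤ (1 - q) f` off `xs`.
  have hgap : ∀ g : X → ℝ, ∑ x, π x * g x = 0 → energy P π g g ≤ (1 - q) * sqNorm π g :=
    fun g hg => energy_le_of_mean_zero hπ hPrev hP hProw (by linarith) hfpos
      (fun x hx => by nlinarith [hPd x hx, hfF x]) (hf0 xs) hg
  have hcontr : ∀ g : X → ℝ, ∑ x, π x * g x = 0 →
      sqNorm π (P.mulVec g) ≤ (1 - q) ^ 2 * sqNorm π g :=
    fun g hg => sqNorm_mulVec_le hπ hPrev hProw (energy_lazy_nonneg hπ.pos hrev hQ hrow)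
      (by linarith) hgap hg
  refine ciSup_le fun A => ?_
  set m : ℝ := ∑ y ∈ A, π y with hm
  -- `a t x` is the discrepancy `P^t(x, A) - π(A)`.
  let a : ℕ → X → ℝ := fun t => (P ^ t).mulVec (fun y => (if y ∈ A then 1 else 0) - m)
  have ha_succ : ∀ t, a (t + 1) = P.mulVec (a t) := fun t => by
    simp only [a, pow_succ', Matrix.mulVec_mulVec]
  have ha0 : ∀ x, a 0 x = (if x ∈ A then 1 else 0) - m := fun x => by simp [a]
  have hm0 : 0 ≤ m := Finset.sum_nonneg fun y _ => (hπ.pos y).le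
  have hm1 : m ≤ 1 := by
    rw [← hπ.sum_eq_one]
    exact Finset.sum_le_univ_sum_of_nonneg fun y => (hπ.pos y).le
  have hind : ∑ x, π x * (if x ∈ A then 1 else 0) = m := by simp [hm]
  have hmean : ∀ t, ∑ x, π x * a t x = 0 := by
    intro t
    induction t with
    | zero =>
      simp_rw [ha0, mul_sub, Finset.sum_sub_distrib]
      rw [hind, ← Finset.sum_mul, hπ.sum_eq_one]; ring
    | succ t ih => rw [ha_succ, sum_mul_mulVec hPrev hProw, ih]
  have hnorm : ∀ t, sqNorm π (a t) ≤ ((1 - q) ^ t) ^ 2 * (1 / 4) := by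
    intro t
    induction t with
    | zero =>
      have : sqNorm π (a 0) = m - m ^ 2 := by
        unfold sqNorm
        have : ∀ x, π x * a 0 x ^ 2 =
            (1 - 2 * m) * (π x * (if x ∈ A then 1 else 0)) + m ^ 2 * π x := fun x => by
          rw [ha0]; split_ifs <;> ring
        simp_rw [this, Finset.sum_add_distrib, ← Finset.mul_sum]
        rw [hind, hπ.sum_eq_one]; ring
      rw [this]; nlinarith [sq_nonneg (m - 1 / 2)]
    | succ t ih =>
      rw [ha_succ]
      refine (hcontr _ (hmean t)).trans ?_
      refine (mul_le_mul_of_nonneg_left ih (sq_nonneg _)).trans (le_of_eq ?_)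
      ring
  -- The variance of an indicator is at most `1/4`, which the mass `1/4` of the atom cancels
  -- exactly.
  have hatom : ∀ t, |a t xs| ≤ (1 - q) ^ t := by
    intro t
    refine abs_le_of_sq_le_sq ?_ (pow_nonneg (by linarith) t)
    have h1 : π xs * a t xs ^ 2 ≤ sqNorm π (a t) :=
      Finset.single_le_sum (f := fun x => π x * a t x ^ 2)
        (fun x _ => mul_nonneg (hπ.pos x).le (sq_nonneg _)) (Finset.mem_univ xs)
    have h2 := mul_le_mul_of_nonneg_right hxs (sq_nonneg (a t xs))
    linarith [hnorm t]
  -- Off `xs`, `u = 1 + f/F ≤ 2` satisfies `P u ≤ u - q ≤ (1 - q/2) u`; at `xs`, where there is no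
  -- drift, `hatom` serves as boundary value.
  have hbound : ∀ t x, |a t x| ≤ (1 - q / 2) ^ t * (1 + f x / F) := by
    intro t
    have hu : ∀ x, 0 ≤ f x / F := fun x => div_nonneg (hf0 x) hF.le
    induction t with
    | zero =>
      intro x
      rw [ha0, pow_zero, one_mul]
      have : |(if x ∈ A then (1 : ℝ) else 0) - m| ≤ 1 := by
        rw [abs_le]; split_ifs <;> constructor <;> linarith
      linarith [hu x]
    | succ t ih =>
      intro x
      by_cases hx : x = xs
      · subst hx
        refine (hatom _).trans ?_
        refine (pow_le_pow_left₀ (by linarith) (by linarith : 1 - q ≤ 1 - q / 2) _).trans ?_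
        exact le_mul_of_one_le_right (pow_nonneg (by linarith) _) (by linarith [hu x])
      · rw [ha_succ]
        refine (abs_mulVec_le hP ih x).trans ?_
        have e : P.mulVec (fun y => (1 - q / 2) ^ t * (1 + f y / F)) x =
            (1 - q / 2) ^ t * (1 + P.mulVec f x / F) := by
          unfold Matrix.mulVec dotProduct
          have : ∀ y, P x y * ((1 - q / 2) ^ t * (1 + f y / F)) =
            (1 - q / 2) ^ t * P x y + (1 - q / 2) ^ t * (P x y * f y / F) := fun y => by ring
          simp_rw [this, Finset.sum_add_distrib, ← Finset.mul_sum, ← Finset.sum_div]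
          rw [hProw x]; ring
        rw [e, pow_succ, mul_assoc]
        refine mul_le_mul_of_nonneg_left ?_ (pow_nonneg (by linarith) _)
        have h1 : P.mulVec f x / F ≤ f x / F - q := by
          rw [hq, ← sub_div]; exact div_le_div_of_nonneg_right (hPd x hx) hF.le
        have h2 : f x / F ≤ 1 := (div_le_one hF).2 (hfF x)
        nlinarith
  have hrowt : ∀ t x, ∑ y, (P ^ t) x y = 1 := by
    intro t
    induction t with
    | zero => intro x; simp [Matrix.one_apply]
    | succ t ih =>
      intro x
      simp_rw [pow_succ', Matrix.mul_apply]
      rw [Finset.sum_comm]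
      simp_rw [← Finset.mul_sum, ih, mul_one]
      exact hProw x
  have hax : a t x = ∑ y ∈ A, (P ^ t) x y - ∑ y ∈ A, π y := by
    simp only [a, Matrix.mulVec, dotProduct]
    simp_rw [mul_sub, Finset.sum_sub_distrib, ← Finset.sum_mul]
    rw [hrowt, one_mul]
    simp [hm]
  rw [← hax, hcF2]
  refine (hbound t x).trans ?_
  have h2 : f x / F ≤ 1 := (div_le_one hF).2 (hfF x)
  have h3 : 0 ≤ (1 - q / 2) ^ t := pow_nonneg (by linarith) t
  nlinarith

end Lazy

/-! ### Clipping and entropy inequalities. -/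

section Clip

variable {u l L : ℝ}

theorem le_clip (h : l ≤ L) : l ≤ clip u l L := by
  unfold clip; split_ifs <;> linarith

theorem clip_le (h : l ≤ L) : clip u l L ≤ L := by
  unfold clip; split_ifs <;> linarith

theorem clip_of_le (h : l ≤ L) (hu : u ≤ l) : clip u l L = l := by
  unfold clip; split_ifs <;> linarith

theorem clip_of_ge (h : l ≤ L) (hu : L ≤ u) : clip u l L = L := by
  unfold clip; split_ifs <;> linarith

theorem clip_le_self (hu : l ≤ u) : clip u l L ≤ u := by
  unfold clip; split_ifs <;> linarith

end Clip

/-- The Gibbs inequality `∑ h log h ≥ Z log (Z / n)` for `Z = ∑ h` over at most `n` terms. -/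
theorem mul_log_div_le_sum_mul_log {α : Type*} (s : Finset α) {h : α → ℝ}
    (hpos : ∀ y ∈ s, 0 < h y) {n : ℝ} (hn : 0 < n) (hs : (s.card : ℝ) ≤ n)
    (hZ : 0 < ∑ y ∈ s, h y) :
    (∑ y ∈ s, h y) * Real.log ((∑ y ∈ s, h y) / n) ≤ ∑ y ∈ s, h y * Real.log (h y) := by
  set Z := ∑ y ∈ s, h y with hZdef
  have ha : 0 < Z / n := div_pos hZ hn
  -- Tangent-line bound for `u log u` at the uniform value `Z / n`.
  have key : ∀ y ∈ s, h y * Real.log (Z / n) + h y - Z / n ≤ h y * Real.log (h y) := by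
    intro y hy
    have h1 := Real.log_le_sub_one_of_pos (div_pos ha (hpos y hy))
    rw [Real.log_div ha.ne' (hpos y hy).ne'] at h1
    have h2 := mul_le_mul_of_nonneg_left h1 (hpos y hy).le
    have h3 : h y * (Z / n / h y - 1) = Z / n - h y := by
      have := (hpos y hy).ne'
      field_simp
    linarith
  have h1 := Finset.sum_le_sum key
  rw [Finset.sum_sub_distrib, Finset.sum_add_distrib, ← Finset.sum_mul, Finset.sum_const,
    nsmul_eq_mul, ← hZdef] at h1
  have h2 : (s.card : ℝ) * (Z / n) ≤ Z :=
    (mul_le_mul_of_nonneg_right hs ha.le).trans (le_of_eq (by field_simp))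
  linarith

/-- `p log r ≥ -q log (1 / q)` whenever `p ≤ min q r`, `r ≤ 1` and `q ≤ 1 / e`. -/
theorem neg_le_mul_log {p q r : ℝ} (hr : 0 < r) (hr1 : r ≤ 1)
    (hpq : p ≤ q) (hpr : p ≤ r) (hq : 0 < q) (hqe : Real.exp 1 ≤ 1 / q) :
    -(q * Real.log (1 / q)) ≤ p * Real.log r := by
  have hlr : Real.log r ≤ 0 := Real.log_nonpos hr.le hr1
  rw [one_div, Real.log_inv, mul_neg, neg_neg]
  rcases le_total q r with h | h
  · have h1 := Real.log_le_log hq h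
    have h2 := mul_le_mul_of_nonpos_right hpq hlr
    have h3 := mul_le_mul_of_nonneg_left h1 hq.le
    linarith
  · have h1 := mul_le_mul_of_nonpos_right hpr hlr
    -- `u log u` decreases on `(0, 1/e]`; this is the antitonicity of `log v / v` on `[e, ∞)` under
    -- `v = 1/u`.
    have hqr : 1 / q ≤ 1 / r := one_div_le_one_div_of_le hr h
    have h2 := Real.log_div_self_antitoneOn (Set.mem_ofPred_eq ▸ hqe)
      (Set.mem_ofPred_eq ▸ hqe.trans hqr) hqr
    simp only [one_div, Real.log_inv, div_inv_eq_mul] at h2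
    linarith

/-! ### The informed chain: proposals, acceptance and reversibility. -/

section Chain

variable {X : Type*} [Fintype X] {G : SimpleGraph X} {π : X → ℝ} {l L : ℝ}

theorem piMin_le (x : X) : piMin π ≤ π x := ciInf_le (Set.finite_range _).bddBelow x

theorem piMin_pos [Nonempty X] (hπ : ∀ x, 0 < π x) : 0 < piMin π := by
  obtain ⟨x, hx⟩ := exists_eq_ciInf_of_finite (f := π)
  rw [piMin, ← hx]; exact hπ x

theorem exists_uphill_of_le_tailRatio {xs : X} (hL : 0 < L) (hLR : L ≤ tailRatio G π xs)
    (x : X) (hx : x ≠ xs) : ∃ y, G.Adj x y ∧ L ≤ π y / π x := by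
  have h1 : L ≤ ⨆ y : {y : X // G.Adj x y}, π y / π x :=
    hLR.trans (ciInf_le (f := fun x : {x : X // x ≠ xs} =>
      ⨆ y : {y : X // G.Adj x y}, π y / π x) (Set.finite_range _).bddBelow ⟨x, hx⟩)
  rcases isEmpty_or_nonempty {y : X // G.Adj x y} with h | h
  -- An empty real supremum is `0`, which `0 < L` excludes.
  · rw [Real.iSup_of_isEmpty] at h1; linarith
  · obtain ⟨y, hy⟩ := exists_eq_ciSup_of_finite (f := fun y : {y : X // G.Adj x y} => π y / π x)
    exact ⟨y, y.2, by rw [← hy] at h1; exact h1⟩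

variable [DecidableRel G.Adj]

theorem normConst_le (hlL : l ≤ L) (hL : 0 ≤ L) (x : X) :
    normConst G π l L x ≤ G.maxDegree * L := by
  unfold normConst
  refine (Finset.sum_le_card_nsmul _ _ L fun y _ => clip_le hlL).trans ?_
  rw [nsmul_eq_mul, SimpleGraph.card_neighborFinset_eq_degree]
  exact mul_le_mul_of_nonneg_right (by exact_mod_cast G.degree_le_maxDegree x) hL

theorem normConst_nonneg (hl : 0 ≤ l) (hlL : l ≤ L) (x : X) : 0 ≤ normConst G π l L x :=
  Finset.sum_nonneg fun _ _ => hl.trans (le_clip hlL)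

theorem le_normConst (hl : 0 ≤ l) (hlL : l ≤ L) {x y : X} (hxy : G.Adj x y)
    (hy : L ≤ π y / π x) : L ≤ normConst G π l L x := by
  have h := Finset.single_le_sum (f := fun y => clip (π y / π x) l L)
    (fun y _ => hl.trans (le_clip hlL)) ((G.mem_neighborFinset x y).2 hxy)
  rwa [clip_of_ge hlL hy] at h

theorem normConst_pos (hl : 0 < l) (hlL : l ≤ L) {x y : X} (hxy : G.Adj x y) :
    0 < normConst G π l L x :=
  Finset.sum_pos (fun _ _ => hl.trans_le (le_clip hlL)) ⟨y, (G.mem_neighborFinset x y).2 hxy⟩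

theorem informedProposal_nonneg (hl : 0 ≤ l) (hlL : l ≤ L) (x y : X) :
    0 ≤ informedProposal G π l L x y := by
  unfold informedProposal
  split_ifs
  · exact div_nonneg (hl.trans (le_clip hlL)) (normConst_nonneg hl hlL x)
  · exact le_rfl

theorem informedProposal_pos (hl : 0 < l) (hlL : l ≤ L) {x y : X} (hxy : G.Adj x y) :
    0 < informedProposal G π l L x y := by
  unfold informedProposal
  rw [if_pos hxy]
  exact div_pos (hl.trans_le (le_clip hlL)) (normConst_pos hl hlL hxy)

theorem informedMove_of_not_adj {x y : X} (h : ¬ G.Adj x y) : informedMove G π l L x y = 0 := by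
  simp [informedMove, informedProposal, h]

theorem informedMove_eq_min (hπ : ∀ x, 0 < π x) (hl : 0 < l) (hlL : l ≤ L) {x y : X}
    (hxy : G.Adj x y) : informedMove G π l L x y =
      min (informedProposal G π l L x y) (π y / π x * informedProposal G π l L y x) := by
  have h1 := informedProposal_pos (π := π) hl hlL hxy
  have h2 := hπ x
  unfold informedMove
  rw [← mul_min_of_nonneg _ _ h1.le |>.symm, mul_one]
  congr 1
  field_simp

theorem informedMove_nonneg (hπ : ∀ x, 0 < π x) (hl : 0 < l) (hlL : l ≤ L) (x y : X) :
    0 ≤ informedMove G π l L x y := by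
  by_cases h : G.Adj x y
  · rw [informedMove_eq_min hπ hl hlL h]
    exact le_min (informedProposal_nonneg hl.le hlL x y)
      (mul_nonneg (div_nonneg (hπ y).le (hπ x).le) (informedProposal_nonneg hl.le hlL y x))
  · rw [informedMove_of_not_adj h]

theorem informedMove_le_proposal (hl : 0 ≤ l) (hlL : l ≤ L) (x y : X) :
    informedMove G π l L x y ≤ informedProposal G π l L x y :=
  mul_le_of_le_one_right (informedProposal_nonneg hl hlL x y) (min_le_left _ _)

theorem informedMove_reversible (hπ : ∀ x, 0 < π x) (hl : 0 < l) (hlL : l ≤ L) (x y : X) :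
    π x * informedMove G π l L x y = π y * informedMove G π l L y x := by
  by_cases h : G.Adj x y
  · rw [informedMove_eq_min hπ hl hlL h, informedMove_eq_min hπ hl hlL h.symm,
      mul_min_of_nonneg _ _ (hπ x).le, mul_min_of_nonneg _ _ (hπ y).le, min_comm]
    have h1 := (hπ x).ne'
    have h2 := (hπ y).ne'
    congr 1 <;> field_simp
  · rw [informedMove_of_not_adj h, informedMove_of_not_adj fun h' => h h'.symm]
    simp

/-- Only an inequality, because a vanishing normalizing constant makes the sum `0 / 0 = 0`. -/
theorem sum_informedProposal_le_one (x : X) :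
    ∑ y, informedProposal G π l L x y ≤ 1 := by
  have : ∑ y, informedProposal G π l L x y = normConst G π l L x / normConst G π l L x := by
    unfold informedProposal
    rw [← Finset.sum_filter, ← Finset.sum_div, ← SimpleGraph.neighborFinset_eq_filter]
    rfl
  rw [this]
  exact div_self_le_one _

/-- Lower bound for one term of the drift of `log π`: the entropy term, up to an error
`2 q log (1 / q)` with `q = M / L`. -/
theorem informedMove_mul_log_ge (hπ : ∀ x, 0 < π x)
    (hM : 1 ≤ G.maxDegree) (hML : (G.maxDegree : ℝ) ^ 2 < L)
    (he : Real.exp 1 ≤ L / G.maxDegree) {x y : X} (hxy : G.Adj x y)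
    (hZx : L ≤ normConst G π G.maxDegree L x)
    (hZy : π y < π x → L ≤ normConst G π G.maxDegree L y) :
    clip (π y / π x) G.maxDegree L / normConst G π G.maxDegree L x *
        Real.log (clip (π y / π x) G.maxDegree L)
      - 2 * (G.maxDegree / L * Real.log (L / G.maxDegree))
      ≤ informedMove G π G.maxDegree L x y * Real.log (π y / π x) := by
  set M : ℝ := (G.maxDegree : ℝ) with hMdef
  have hM1 : 1 ≤ M := by rw [hMdef]; exact_mod_cast hM
  have hM0 : 0 < M := by linarith
  have hMltL : M ≤ L := by nlinarith
  have hL0 : 0 < L := by linarith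
  set r := π y / π x with hr
  have hrpos : 0 < r := div_pos (hπ y) (hπ x)
  have hinv : π x / π y = 1 / r := by rw [hr, one_div_div]
  have hq0 : 0 < M / L := div_pos hM0 hL0
  have hq1 : 1 / (M / L) = L / M := one_div_div _ _
  have hlogLM : Real.log M ≤ Real.log (L / M) :=
    Real.log_le_log hM0 ((le_div_iff₀ hM0).2 (by nlinarith))
  have hlogM : 0 ≤ Real.log M := Real.log_nonneg hM1
  set Z := normConst G π M L x with hZ
  have hZ0 : 0 < Z := hL0.trans_le hZx
  have hprop : informedProposal G π M L x y = clip r M L / Z := by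
    simp [informedProposal, hxy, hr, hZ]
  have hprop' : informedProposal G π M L y x = clip (1 / r) M L / normConst G π M L y := by
    simp [informedProposal, hxy.symm, ← hinv]
  have hmove := informedMove_eq_min (G := G) (π := π) (L := L) hπ hM0 hMltL hxy
  rw [hprop, hprop', ← hr] at hmove
  have herr : M / Z * Real.log M ≤ M / L * Real.log (L / M) :=
    mul_le_mul (div_le_div_of_nonneg_left hM0.le hL0 hZx) hlogLM hlogM hq0.le
  have herr0 : 0 ≤ M / L * Real.log (L / M) := mul_nonneg hq0.le (hlogM.trans hlogLM)
  rcases le_or_gt M r with h | h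
  -- No rejection for `r ≥ M`: the reverse weight is clipped up to `M` and `Z(y) ≤ M L`, so `K(y,x)
  -- ≥ 1/L`, while `K(x,y) ≤ r/L` because `Z(x) ≥ L`. This is why `ℓ = M`.
  · have hacc : informedMove G π M L x y = clip r M L / Z := by
      rw [hmove, min_eq_left]
      have h1r : 1 / r ≤ M := ((div_le_one hrpos).2 (by linarith)).trans hM1
      rw [clip_of_le hMltL h1r]
      have h1 : clip r M L / Z ≤ r / L :=
        div_le_div₀ hrpos.le (clip_le_self h) hL0 hZx
      have h2 : r / L ≤ r * (M / normConst G π M L y) := by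
        rw [div_eq_mul_inv]
        refine mul_le_mul_of_nonneg_left ?_ hrpos.le
        have hpos := normConst_pos (π := π) hM0 hMltL hxy.symm
        rw [inv_eq_one_div, div_le_div_iff₀ hL0 hpos, one_mul]
        exact normConst_le hMltL hL0.le y
      exact h1.trans h2
    rw [hacc]
    have hc0 : 0 < clip r M L := hM0.trans_le (le_clip hMltL)
    have := mul_le_mul_of_nonneg_left (Real.log_le_log hc0 (clip_le_self (L := L) h))
      (div_nonneg hc0.le hZ0.le)
    linarith
  · rw [clip_of_le hMltL h.le] at hmove ⊢
    -- For `1 ≤ r < M` the move contributes nonnegatively, and only the entropy term `(M/Z) log M`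
    -- is lost. For `r < 1` the loss of the move itself is bounded using both `p ≤ M/L` and `p ≤ r`.
    rcases le_or_gt 1 r with h1 | h1
    · have := mul_nonneg (informedMove_nonneg (G := G) hπ hM0 hMltL x y) (Real.log_nonneg h1)
      linarith
    · have hZy' := hZy ((div_lt_one (hπ x)).1 h1)
      have hp1 : informedMove G π M L x y ≤ M / L := by
        rw [hmove]
        exact (min_le_left _ _).trans (div_le_div_of_nonneg_left hM0.le hL0 hZx)
      have hp2 : informedMove G π M L x y ≤ r := by
        rw [hmove]
        refine (min_le_right _ _).trans (mul_le_of_le_one_right hrpos.le ?_)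
        exact (div_le_one (hL0.trans_le hZy')).2 ((clip_le hMltL).trans hZy')
      have := neg_le_mul_log hrpos h1.le hp1 hp2 hq0 (by rwa [hq1])
      rw [hq1] at this
      linarith

/-! ### The transition matrix and the drift of `log π`. -/

variable [DecidableEq X]

theorem informedMH_of_ne {x y : X} (h : y ≠ x) :
    informedMH G π l L x y = informedMove G π l L x y := if_neg h

theorem informedMH_nonneg (hπ : ∀ x, 0 < π x) (hl : 0 < l) (hlL : l ≤ L) (x y : X) :
    0 ≤ informedMH G π l L x y := by
  unfold informedMH
  split_ifs
  · rw [sub_nonneg]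
    refine le_trans ?_ (sum_informedProposal_le_one (G := G) (π := π) (l := l) (L := L) x)
    refine (Finset.sum_le_sum fun z _ => informedMove_le_proposal hl.le hlL x z).trans ?_
    exact Finset.sum_le_univ_sum_of_nonneg fun z => informedProposal_nonneg hl.le hlL x z
  · exact informedMove_nonneg hπ hl hlL x y

theorem informedMH_sum_row (x : X) : ∑ y, informedMH G π l L x y = 1 := by
  rw [← Finset.add_sum_erase _ _ (Finset.mem_univ x),
    Finset.sum_congr rfl fun y hy => informedMH_of_ne (Finset.ne_of_mem_erase hy)]
  simp [informedMH]

theorem informedMH_reversible (hπ : ∀ x, 0 < π x) (hl : 0 < l) (hlL : l ≤ L) (x y : X) :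
    π x * informedMH G π l L x y = π y * informedMH G π l L y x := by
  by_cases h : x = y
  · rw [h]
  · rw [informedMH_of_ne (Ne.symm h), informedMH_of_ne h, informedMove_reversible hπ hl hlL]

theorem informedMH_mulVec (f : X → ℝ) (x : X) :
    (informedMH G π l L).mulVec f x =
      f x + ∑ y ∈ G.neighborFinset x, informedMove G π l L x y * (f y - f x) := by
  have h1 : (informedMH G π l L).mulVec f x - f x =
      ∑ y, informedMH G π l L x y * (f y - f x) := by
    simp_rw [mul_sub, Finset.sum_sub_distrib, ← Finset.sum_mul, informedMH_sum_row, one_mul]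
    rfl
  have h2 : ∑ y, informedMH G π l L x y * (f y - f x) =
      ∑ y ∈ G.neighborFinset x, informedMove G π l L x y * (f y - f x) := by
    symm
    rw [Finset.sum_congr rfl fun y hy => by
      rw [← informedMH_of_ne (G.ne_of_adj ((G.mem_neighborFinset x y).1 hy)).symm]]
    refine Finset.sum_subset (Finset.subset_univ _) fun y _ hy => ?_
    by_cases hyx : y = x
    · rw [hyx]; simp
    · rw [informedMH_of_ne hyx,
        informedMove_of_not_adj fun h => hy ((G.mem_neighborFinset x y).2 h), zero_mul]
  rw [← h2, ← h1]; ring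

theorem informedMH_drift (hπ : ∀ x, 0 < π x)
    (hM : 1 ≤ G.maxDegree) (hML : (G.maxDegree : ℝ) ^ 2 < L)
    (he : Real.exp 1 ≤ L / G.maxDegree) {xs : X} (hxs : ∀ x, π x ≤ π xs)
    (hup : ∀ x, x ≠ xs → ∃ y, G.Adj x y ∧ L ≤ π y / π x) {x : X} (hx : x ≠ xs) :
    (informedMH G π G.maxDegree L).mulVec (fun z => Real.log (π xs / π z)) x ≤
      Real.log (π xs / π x) -
        (1 - 2 * ((G.maxDegree : ℝ) ^ 2 / L)) * Real.log (L / G.maxDegree) := by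
  set M : ℝ := (G.maxDegree : ℝ) with hMdef
  have hM1 : 1 ≤ M := by rw [hMdef]; exact_mod_cast hM
  have hM0 : 0 < M := by linarith
  have hMltL : M ≤ L := by nlinarith
  have hL0 : 0 < L := by linarith
  have hZ : ∀ z, z ≠ xs → L ≤ normConst G π M L z := fun z hz => by
    obtain ⟨y, hy, hr⟩ := hup z hz
    exact le_normConst hM0.le hMltL hy hr
  have hZx := hZ x hx
  have hZ0 := hL0.trans_le hZx
  rw [informedMH_mulVec]
  have hterm : ∀ y, Real.log (π xs / π y) - Real.log (π xs / π x) = -Real.log (π y / π x) :=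
    fun y => by
      rw [Real.log_div (hπ xs).ne' (hπ y).ne', Real.log_div (hπ xs).ne' (hπ x).ne',
        Real.log_div (hπ y).ne' (hπ x).ne']; ring
  simp_rw [hterm, mul_neg, Finset.sum_neg_distrib]
  have h1 := Finset.sum_le_sum fun y (hy : y ∈ G.neighborFinset x) =>
    informedMove_mul_log_ge hπ hM hML he ((G.mem_neighborFinset x y).1 hy) hZx
      -- A neighbour less likely than `x` is not the mode, so its normalizing constant is also at
      -- least `L`.
      fun hlt => hZ y fun h => by subst h; exact absurd (hxs x) (not_le.2 hlt)
  rw [← hMdef, Finset.sum_sub_distrib, Finset.sum_const, nsmul_eq_mul] at h1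
  have hcard : ((G.neighborFinset x).card : ℝ) ≤ M := by
    rw [SimpleGraph.card_neighborFinset_eq_degree, hMdef]
    exact_mod_cast G.degree_le_maxDegree x
  have h2 := mul_log_div_le_sum_mul_log (G.neighborFinset x)
    (h := fun y => clip (π y / π x) M L) (fun y _ => hM0.trans_le (le_clip hMltL)) hM0 hcard hZ0
  have h3 : Real.log (L / M) ≤
      ∑ y ∈ G.neighborFinset x, clip (π y / π x) M L / normConst G π M L x *
        Real.log (clip (π y / π x) M L) := by
    have e : ∑ y ∈ G.neighborFinset x, clip (π y / π x) M L / normConst G π M L x *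
        Real.log (clip (π y / π x) M L) =
        (∑ y ∈ G.neighborFinset x, clip (π y / π x) M L * Real.log (clip (π y / π x) M L)) /
          normConst G π M L x := by
      rw [Finset.sum_div]; exact Finset.sum_congr rfl fun y _ => by ring
    rw [e, le_div_iff₀ hZ0]
    have h4 : Real.log (L / M) ≤ Real.log (normConst G π M L x / M) :=
      Real.log_le_log (div_pos hL0 hM0) (div_le_div_of_nonneg_right hZx hM0.le)
    have h5 := mul_le_mul_of_nonneg_right h4 hZ0.le
    change normConst G π M L x * Real.log (normConst G π M L x / M) ≤ _ at h2
    linarith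
  have hlog0 : 0 ≤ Real.log (L / M) := Real.log_nonneg (by
    linarith [Real.add_one_le_exp (1 : ℝ)])
  have h6 : ((G.neighborFinset x).card : ℝ) * (2 * (M / L * Real.log (L / M))) ≤
      2 * (M ^ 2 / L) * Real.log (L / M) := by
    refine (mul_le_mul_of_nonneg_right hcard (by positivity)).trans (le_of_eq ?_)
    ring
  linarith

/-! ### Mass of the mode and the mixing-time bound. -/

/-- If every state but `xs` has a neighbour at least `L` times as likely, then `xs` carries mass
at least `1 - M / L`. -/
theorem one_sub_le_of_uphill (hπ : IsPosDistribution π) (hL : 0 < L) {xs : X}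
    (hup : ∀ x, x ≠ xs → ∃ y, G.Adj x y ∧ L ≤ π y / π x) :
    1 - G.maxDegree / L ≤ π xs := by
  have h1 : ∀ x ∈ Finset.univ.erase xs, π x ≤ ∑ y ∈ G.neighborFinset x, π y / L := by
    intro x hx
    obtain ⟨y, hy, hr⟩ := hup x (Finset.ne_of_mem_erase hx)
    rw [le_div_iff₀ (hπ.pos x)] at hr
    have h2 : π x ≤ π y / L := (le_div_iff₀ hL).2 (by linarith)
    exact h2.trans (Finset.single_le_sum (f := fun y => π y / L)
      (fun y _ => div_nonneg (hπ.pos y).le hL.le) ((G.mem_neighborFinset x y).2 hy))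
  -- Double counting: each `y` is charged once by each of its at most `M` neighbours.
  have h2 : ∑ x, ∑ y ∈ G.neighborFinset x, π y / L ≤ G.maxDegree / L := by
    rw [Finset.sum_comm' (t' := Finset.univ) (s' := fun y => G.neighborFinset y)
      (by intro x y; simp [G.adj_comm])]
    have : ∀ y ∈ Finset.univ, ∑ x ∈ G.neighborFinset y, π y / L ≤ π y * (G.maxDegree / L) := by
      intro y _
      rw [Finset.sum_const, nsmul_eq_mul, SimpleGraph.card_neighborFinset_eq_degree]
      have h3 : (G.degree y : ℝ) ≤ G.maxDegree := by exact_mod_cast G.degree_le_maxDegree y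
      have := mul_le_mul_of_nonneg_right h3 (div_nonneg (hπ.pos y).le hL.le)
      refine this.trans (le_of_eq ?_)
      ring
    refine (Finset.sum_le_sum this).trans (le_of_eq ?_)
    rw [← Finset.sum_mul, hπ.sum_eq_one, one_mul]
  have h3 := Finset.add_sum_erase Finset.univ π (Finset.mem_univ xs)
  rw [hπ.sum_eq_one] at h3
  have h4 : ∑ x ∈ Finset.univ.erase xs, ∑ y ∈ G.neighborFinset x, π y / L ≤
      ∑ x, ∑ y ∈ G.neighborFinset x, π y / L :=
    Finset.sum_le_univ_sum_of_nonneg fun x =>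
      Finset.sum_nonneg fun y _ => div_nonneg (hπ.pos y).le hL.le
  linarith [Finset.sum_le_sum h1]

theorem mixingTime_le {P : Matrix X X ℝ} {ε : ℝ} {N : ℕ}
    (h : ∀ x, tvDist ((P ^ N) x) π ≤ ε) : mixingTime P π ε ≤ N :=
  iSup_le fun x => iInf₂_le N (h x)

/-- Quantitative form: `η` enters only through the smallness of `M² / L`. -/
theorem mixingTime_lazy_informedMH_le [Nontrivial X] (hG : G.Connected)
    (hπ : IsPosDistribution π) {xs : X} (hxs : ∀ x, π x ≤ π xs)
    (hML : (G.maxDegree : ℝ) ^ 2 < L) (hLR : L ≤ tailRatio G π xs) {η : ℝ} (hη : 0 < η)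
    (hsmall : (G.maxDegree : ℝ) ^ 2 * Real.log (1 / piMin π) /
        (L * Real.log (L / G.maxDegree)) < min (1 / 4) (η / (2 * (1 + η))))
    {ε : ℝ} (hε : 0 < ε) (hε' : ε < 1 / 2) :
    ∃ t : ℕ, mixingTime (lazy (informedMH G π G.maxDegree L)) π ε = (t : ℕ∞) ∧
        (t : ℝ) ≤ (1 + η) *
          (4 * Real.log (2 * Real.exp 1 / ε) / Real.log (L / G.maxDegree) *
            Real.log (1 / piMin π)) := by
  have hM : 1 ≤ G.maxDegree :=
    (hG.preconnected.degree_pos_of_nontrivial xs).trans_le (G.degree_le_maxDegree xs)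
  set M : ℝ := (G.maxDegree : ℝ) with hMdef
  have hM1 : 1 ≤ M := by rw [hMdef]; exact_mod_cast hM
  have hM0 : 0 < M := by linarith
  have hMltL : M < L := by nlinarith
  have hL0 : 0 < L := by linarith
  have hup := exists_uphill_of_le_tailRatio hL0 hLR
  have hlam : 0 < Real.log (L / M) := Real.log_pos ((one_lt_div hM0).2 hMltL)
  have hmin := piMin_pos (π := π) hπ.pos
  have hle1 : ∀ x, π x ≤ 1 := fun x => by
    rw [← hπ.sum_eq_one]
    exact Finset.single_le_sum (fun y _ => (hπ.pos y).le) (Finset.mem_univ x)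
  set F := Real.log (1 / piMin π) with hF
  -- An uphill edge has ratio at most `1 / piMin π`. Hence `F / log (L/M) ≥ 1`, and the smallness
  -- hypothesis bounds `M² / L` itself.
  have hlamF : Real.log (L / M) ≤ F := by
    obtain ⟨x, hx⟩ := exists_ne xs
    obtain ⟨y, -, hr⟩ := hup x hx
    refine Real.log_le_log (div_pos hL0 hM0) ?_
    refine (div_le_self hL0.le hM1).trans (hr.trans ?_)
    exact div_le_div₀ zero_le_one (hle1 y) hmin (piMin_le x)
  have hF0 : 0 < F := hlam.trans_le hlamF
  have hA : M ^ 2 / L < min (1 / 4) (η / (2 * (1 + η))) := by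
    refine lt_of_le_of_lt ?_ hsmall
    rw [mul_div_mul_comm]
    exact le_mul_of_one_le_right (by positivity) ((one_le_div hlam).2 hlamF)
  obtain ⟨hA1, hA2⟩ := lt_min_iff.1 hA
  have hq : M / L ≤ M ^ 2 / L := div_le_div_of_nonneg_right (by nlinarith) hL0.le
  have hLM4 : 4 ≤ L / M := by
    rw [le_div_iff₀ hM0]
    have := hq.trans hA1.le
    rw [div_le_iff₀ hL0] at this
    linarith
  have hatom : 1 / 4 ≤ π xs := by
    have := one_sub_le_of_uphill hπ hL0 hup
    rw [← hMdef] at this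
    linarith
  have he : Real.exp 1 ≤ L / M := by linarith [Real.exp_one_lt_d9]
  -- Chosen because `1 - 2 · η / (2(1 + η)) = 1 / (1 + η)`: the non-lazy drift is then at least
  -- `2c`.
  set c := Real.log (L / M) / (2 * (1 + η)) with hc
  have hc0 : 0 < c := by positivity
  have hc2 : 2 * c ≤ Real.log (L / M) := by
    rw [hc, ← mul_div_assoc, div_le_iff₀ (by positivity)]
    nlinarith
  have hcdrift : 2 * c ≤ (1 - 2 * (M ^ 2 / L)) * Real.log (L / M) := by
    have h1 : 2 * c = (1 - 2 * (η / (2 * (1 + η)))) * Real.log (L / M) := by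
      rw [hc]; field_simp; ring
    rw [h1]
    exact mul_le_mul_of_nonneg_right (by linarith) hlam.le
  have hcF : c ≤ F := by linarith
  set B := (1 + η) * (4 * Real.log (2 * Real.exp 1 / ε) / Real.log (L / M) * F) with hB
  have hlogε : 0 < Real.log (2 * Real.exp 1 / ε) := by
    refine Real.log_pos ((one_lt_div hε).2 ?_)
    linarith [Real.add_one_le_exp (1 : ℝ)]
  have hB0 : 0 ≤ B := by positivity
  have hBc : B * (c / (2 * F)) = Real.log (2 * Real.exp 1 / ε) := by
    rw [hB, hc]; field_simp; norm_num
  have htv : ∀ x, tvDist ((lazy (informedMH G π M L) ^ ⌊B⌋₊) x) π ≤ ε := by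
    intro x
    refine (tvDist_lazy_pow_le hπ (informedMH_reversible hπ.pos hM0 hMltL.le)
      (informedMH_nonneg hπ.pos hM0 hMltL.le) informedMH_sum_row hatom
      (f := fun z => Real.log (π xs / π z)) (F := F) (c := c)
      (fun z => Real.log_nonneg ((one_le_div (hπ.pos z)).2 (hxs z)))
      (fun z => Real.log_le_log (div_pos (hπ.pos xs) (hπ.pos z))
        (div_le_div₀ zero_le_one (hle1 xs) hmin (piMin_le z)))
      hF0 hc0 hcF
      (fun z hz => (informedMH_drift hπ.pos hM hML he hxs hup hz).trans (by linarith))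
      ⌊B⌋₊ x).trans ?_
    set k := c / (2 * F) with hk
    have hk0 : 0 ≤ k := by positivity
    have hk1 : k ≤ 1 := (div_le_one (by positivity)).2 (by linarith)
    have h1 : (1 - k) ^ ⌊B⌋₊ ≤ Real.exp (-k) ^ ⌊B⌋₊ :=
      pow_le_pow_left₀ (by linarith) (Real.one_sub_le_exp_neg k) _
    rw [← Real.exp_nat_mul] at h1
    -- Rounding `B` down loses at most `k ≤ 1` in the exponent; the factor `e` in `2e/ε` pays for it
    -- and the `2` absorbs the prefactor of `tvDist_lazy_pow_le`.
    have h2 : (⌊B⌋₊ : ℝ) * -k ≤ 1 - Real.log (2 * Real.exp 1 / ε) := by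
      have := mul_le_mul_of_nonneg_right (Nat.lt_floor_add_one B).le hk0
      rw [hBc] at this
      linarith
    have h3 := h1.trans (Real.exp_le_exp.2 h2)
    rw [Real.exp_sub, Real.exp_log (by positivity)] at h3
    have h4 : Real.exp 1 / (2 * Real.exp 1 / ε) = ε / 2 := by
      have := Real.exp_ne_zero (1 : ℝ)
      field_simp
    linarith
  have hle := mixingTime_le htv
  obtain ⟨t, ht⟩ := ENat.ne_top_iff_exists.1 (ne_top_of_le_ne_top (ENat.natCast_ne_top _) hle)
  refine ⟨t, ht.symm, ?_⟩
  rw [← ht] at hle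
  exact (Nat.cast_le.2 (ENat.natCast_le_natCast.1 hle)).trans (Nat.floor_le hB0)

end Chain

end InformedMH

theorem theorem3 {ι : Type*} (l : Filter ι) (X : ι → Type*)
    [∀ i, Fintype (X i)] [∀ i, DecidableEq (X i)] [∀ i, Nontrivial (X i)]
    (G : ∀ i, SimpleGraph (X i)) [∀ i, DecidableRel (G i).Adj]
    (hG : ∀ i, (G i).Connected)
    (π : ∀ i, X i → ℝ) (hπ : ∀ i, InformedMH.IsPosDistribution (π i))
    (xstar : ∀ i, X i) (hxstar : ∀ i x, π i x ≤ π i (xstar i))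
    (L : ι → ℝ)
    (hR : ∀ i, ((G i).maxDegree : ℝ) ^ 2 < InformedMH.tailRatio (G i) (π i) (xstar i))
    (hML : ∀ i, ((G i).maxDegree : ℝ) ^ 2 < L i)
    (hLR : ∀ i, L i ≤ InformedMH.tailRatio (G i) (π i) (xstar i))
    (hlim : Filter.Tendsto
      (fun i => ((G i).maxDegree : ℝ) ^ 2 * Real.log (1 / InformedMH.piMin (π i)) /
        (L i * Real.log (L i / ((G i).maxDegree : ℝ)))) l (nhds 0)) :
    ∀ η : ℝ, 0 < η → ∀ᶠ i in l, ∀ ε : ℝ, 0 < ε → ε < 1 / 2 →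
      ∃ t : ℕ,
        InformedMH.mixingTime
          (InformedMH.lazy
            (InformedMH.informedMH (G i) (π i) ((G i).maxDegree : ℝ) (L i))) (π i) ε = (t : ℕ∞) ∧
        (t : ℝ) ≤ (1 + η) *
          (4 * Real.log (2 * Real.exp 1 / ε) / Real.log (L i / ((G i).maxDegree : ℝ)) *
            Real.log (1 / InformedMH.piMin (π i))) := by
  intro η hη
  -- The threshold does not involve `ε`, which makes the bound uniform in `ε`.
  filter_upwards [hlim.eventually_lt_const
    (show (0 : ℝ) < min (1 / 4) (η / (2 * (1 + η))) by positivity)] with i hi ε hε hε'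
  exact InformedMH.mixingTime_lazy_informedMH_le (hG i) (hπ i) (hxstar i) (hML i) (hLR i) hη hi
    hε hε'
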